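/- \textbf{Theorem.} Let $E$ be a (real) Banach lattice and let $E'$ be its norm dual, with the dual norm and the dual order ($f \le g$ iff $f(x) \le g(x)$ for all $x \ge 0$), so that $E'$ is a Banach lattice. The following statements are equivalent: \begin{enumerate} \item $E'$ is order continuous, i.e. every net in $E'$ that decreases and has infimum $0$ converges to $0$ in norm. \item Every nonempty (L)-set of $E'$ is an L-weakly compact subset of $E'$. \item For every Banach space $X$, every Dunford--Pettis operator $T : E \to X$ is uaw-Dunford--Pettis. \end{enumerate} Here: operators are bounded and linear; a bounded set $A \subseteq E'$ is an \emph{(L)-set} if $\sup_{f\in A} |f(x_n)| \to 0$ for every weakly null sequence $(x_n)$ in $E$; a nonempty bounded subset $A$ of a Banach lattice $F$ is \emph{L-weakly compact} if $\|y_n\| \to 0$ for every disjoint sequence $(y_n)$ (i.e. $|y_m| \wedge |y_n| = 0$ for $m \ne n$) in the solid hull $\{y \in F : |y| \le |a| \text{ for some } a \in A\}$ of $A$; $T$ is \emph{Dunford--Pettis} if $\|Tx_n\| \to 0$ for every weakly null sequence $(x_n)$ in $E$; a sequence $(x_n)$ in $E$ is \emph{uaw-null} if $|x_n| \wedge u \to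 0$ weakly for every $0 \le u \in E$; and $T$ is \emph{uaw-Dunford--Pettis} if $\|Tx_n\| \to 0$ for every norm bounded uaw-null sequence $(x_n)$ in $E$. -/

import Mathlib

open Filter Topology

universe u v

/-! ### The norm dual of a Banach lattice is a Banach lattice

The dual `E'` is `StrongDual ℝ E`.  It is ordered by `f ≤ g ↔ ∀ x ≥ 0, f x ≤ g x`; the lattice
operations are given by the Riesz-Kantorovich formula. -/

namespace BanachLatticeDual

set_option linter.unusedSectionVars false

variable {E : Type u} [NormedAddCommGroup E] [NormedSpace ℝ E] [Lattice E]

theorem ext_nonneg [IsOrderedAddMonoid E] {f g : StrongDual ℝ E}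
    (h : ∀ x : E, 0 ≤ x → f x = g x) : f = g := by
  ext x
  rw [← posPart_sub_negPart x, map_sub, map_sub, h _ (posPart_nonneg x), h _ (negPart_nonneg x)]

/-- The dual order: `f ≤ g` iff `f x ≤ g x` for all `x ≥ 0`. -/
instance instPartialOrder [IsOrderedAddMonoid E] : PartialOrder (StrongDual ℝ E) where
  le f g := ∀ x : E, 0 ≤ x → f x ≤ g x
  le_refl _ _ _ := le_rfl
  le_trans _ _ _ h₁ h₂ x hx := (h₁ x hx).trans (h₂ x hx)
  le_antisymm _ _ h₁ h₂ := ext_nonneg fun x hx => (h₁ x hx).antisymm (h₂ x hx)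

theorem le_def [IsOrderedAddMonoid E] {f g : StrongDual ℝ E} :
    f ≤ g ↔ ∀ x : E, 0 ≤ x → f x ≤ g x := Iff.rfl

instance instIsOrderedAddMonoid [IsOrderedAddMonoid E] :
    IsOrderedAddMonoid (StrongDual ℝ E) where
  add_le_add_left f g h k x hx := by
    simpa using h x hx

instance instIsOrderedModule [IsOrderedAddMonoid E] : IsOrderedModule ℝ (StrongDual ℝ E) where
  smul_le_smul_of_nonneg_left a ha f g h x hx := by
    simpa using mul_le_mul_of_nonneg_left (h x hx) ha
  smul_le_smul_of_nonneg_right f hf a b h x hx := by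
    have h0 : 0 ≤ f x := by simpa using hf x hx
    simpa using mul_le_mul_of_nonneg_right h h0

/-- `x ↦ sup {f y : 0 ≤ y ≤ x}`, the value of the positive part of `f` at `x ≥ 0`. -/
noncomputable def posValue (f : StrongDual ℝ E) (x : E) : ℝ := sSup (f '' Set.Icc 0 x)

variable [IsOrderedAddMonoid E] [HasSolidNorm E]

theorem apply_le_norm_mul {f : StrongDual ℝ E} {x y : E} (h : |y| ≤ |x|) : f y ≤ ‖f‖ * ‖x‖ :=
  ((le_abs_self _).trans (f.le_opNorm y)).trans
    (mul_le_mul_of_nonneg_left (norm_le_norm_of_abs_le_abs h) (norm_nonneg f))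

theorem apply_le_norm_mul_of_mem {f : StrongDual ℝ E} {x y : E} (h : y ∈ Set.Icc 0 x) :
    f y ≤ ‖f‖ * ‖x‖ :=
  apply_le_norm_mul (by rw [abs_of_nonneg h.1, abs_of_nonneg (h.1.trans h.2)]; exact h.2)

theorem le_posValue (f : StrongDual ℝ E) {x y : E} (h : y ∈ Set.Icc 0 x) :
    f y ≤ posValue f x :=
  le_csSup ⟨‖f‖ * ‖x‖, by rintro _ ⟨z, hz, rfl⟩; exact apply_le_norm_mul_of_mem hz⟩ ⟨y, h, rfl⟩

theorem posValue_le {f : StrongDual ℝ E} {x : E} (hx : 0 ≤ x) {c : ℝ}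
    (h : ∀ y ∈ Set.Icc 0 x, f y ≤ c) : posValue f x ≤ c :=
  csSup_le ⟨_, 0, ⟨le_rfl, hx⟩, rfl⟩ (by rintro _ ⟨z, hz, rfl⟩; exact h z hz)

theorem posValue_nonneg (f : StrongDual ℝ E) {x : E} (hx : 0 ≤ x) : 0 ≤ posValue f x := by
  simpa using le_posValue f (x := x) (y := 0) ⟨le_rfl, hx⟩

theorem posValue_add (f : StrongDual ℝ E) {x y : E} (hx : 0 ≤ x) (hy : 0 ≤ y) :
    posValue f (x + y) = posValue f x + posValue f y := by
  apply le_antisymm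
  · refine posValue_le (add_nonneg hx hy) fun z hz => ?_
    have h1 : f (z ⊓ x) ≤ posValue f x := le_posValue f ⟨le_inf hz.1 hx, inf_le_right⟩
    have h2 : f (z - z ⊓ x) ≤ posValue f y := by
      refine le_posValue f ⟨sub_nonneg.2 inf_le_left, ?_⟩
      rw [sub_le_iff_le_add, add_comm, ← sub_le_iff_le_add]
      exact le_inf (sub_le_self z hy) (sub_le_iff_le_add.2 hz.2)
    rw [map_sub] at h2
    linarith
  · rw [← le_sub_iff_add_le]
    refine posValue_le hx fun z hz => ?_
    rw [le_sub_comm]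
    refine posValue_le hy fun w hw => ?_
    have := le_posValue f (x := x + y) (y := z + w)
      ⟨add_nonneg hz.1 hw.1, add_le_add hz.2 hw.2⟩
    rw [map_add] at this
    linarith

theorem posValue_sub (f : StrongDual ℝ E) {a b : E} (ha : 0 ≤ a) (hb : 0 ≤ b) :
    posValue f (a - b)⁺ - posValue f (a - b)⁻ = posValue f a - posValue f b := by
  have h : (a - b)⁺ + b = (a - b)⁻ + a := by
    have := posPart_sub_negPart (a - b)
    rw [sub_eq_sub_iff_add_eq_add] at this
    rw [this, add_comm]
  have h' := congrArg (posValue f) h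
  rw [posValue_add f (posPart_nonneg _) hb, posValue_add f (negPart_nonneg _) ha] at h'
  linarith

theorem posValue_le_norm (f : StrongDual ℝ E) {x y : E} (hx : 0 ≤ x) (h : x ≤ |y|) :
    posValue f x ≤ ‖f‖ * ‖y‖ :=
  posValue_le hx fun z hz => apply_le_norm_mul (by rw [abs_of_nonneg hz.1]; exact hz.2.trans h)

/-- The positive part of `f` in the dual, as an additive map. -/
noncomputable def posAddHom (f : StrongDual ℝ E) : E →+ ℝ :=
  AddMonoidHom.mk' (fun x => posValue f x⁺ - posValue f x⁻) fun x y => by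
    have h : x + y = (x⁺ + y⁺) - (x⁻ + y⁻) := by
      nth_rw 1 [← posPart_sub_negPart x, ← posPart_sub_negPart y]
      abel
    have hx := posPart_nonneg x
    have hy := posPart_nonneg y
    have hx' := negPart_nonneg x
    have hy' := negPart_nonneg y
    rw [h, posValue_sub f (add_nonneg hx hy) (add_nonneg hx' hy'), posValue_add f hx hy,
      posValue_add f hx' hy']
    abel

theorem norm_posAddHom_le (f : StrongDual ℝ E) (x : E) : ‖posAddHom f x‖ ≤ ‖f‖ * ‖x‖ := by
  change |posValue f x⁺ - posValue f x⁻| ≤ _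
  have h1 := posValue_nonneg f (posPart_nonneg x)
  have h2 := posValue_nonneg f (negPart_nonneg x)
  have h3 := posValue_le_norm f (posPart_nonneg x)
    (sup_le (le_abs_self x) (abs_nonneg x) : x⁺ ≤ |x|)
  have h4 := posValue_le_norm f (negPart_nonneg x)
    (sup_le (neg_le_abs x) (abs_nonneg x) : x⁻ ≤ |x|)
  rw [abs_le]
  constructor <;> linarith

/-- The positive part of `f` in the dual. -/
noncomputable def pos (f : StrongDual ℝ E) : StrongDual ℝ E :=
  (posAddHom f).toRealLinearMap
    (AddMonoidHomClass.continuous_of_bound (posAddHom f) ‖f‖ (norm_posAddHom_le f))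

theorem pos_apply (f : StrongDual ℝ E) {x : E} (hx : 0 ≤ x) : pos f x = posValue f x := by
  change posValue f x⁺ - posValue f x⁻ = _
  have := posValue_sub f hx le_rfl
  rw [sub_zero] at this
  have h0 : posValue f 0 = 0 := by
    have := posValue_add f (le_refl (0 : E)) le_rfl
    rw [add_zero] at this
    linarith
  rw [this, h0, sub_zero]

theorem le_pos (f : StrongDual ℝ E) : f ≤ pos f := fun x hx => by
  rw [pos_apply f hx]
  exact le_posValue f ⟨hx, le_rfl⟩

theorem pos_nonneg (f : StrongDual ℝ E) : 0 ≤ pos f := fun x hx => by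
  rw [pos_apply f hx]
  exact posValue_nonneg f hx

theorem pos_le {f g : StrongDual ℝ E} (h : f ≤ g) (hg : 0 ≤ g) : pos f ≤ g := fun x hx => by
  rw [pos_apply f hx]
  refine posValue_le hx fun y hy => (h y hy.1).trans ?_
  have h0 : 0 ≤ g (x - y) := hg (x - y) (sub_nonneg.2 hy.2)
  rw [map_sub] at h0
  linarith

theorem le_add_pos_right (f g : StrongDual ℝ E) : f ≤ g + pos (f - g) :=
  sub_le_iff_le_add'.1 (le_pos (f - g))

theorem le_add_pos_left (f g : StrongDual ℝ E) : g ≤ g + pos (f - g) :=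
  le_add_of_nonneg_right (pos_nonneg (f - g))

theorem add_pos_le {f g h : StrongDual ℝ E} (hf : f ≤ h) (hg : g ≤ h) : g + pos (f - g) ≤ h :=
  le_sub_iff_add_le'.1 (pos_le (sub_le_sub_right hf g) (sub_nonneg.2 hg))

/-- The lattice structure of the dual: `f ⊔ g = g + (f - g)⁺` and `f ⊓ g = -((-f) ⊔ (-g))`. -/
noncomputable instance instLattice : Lattice (StrongDual ℝ E) where
  __ := instPartialOrder
  sup f g := g + pos (f - g)
  le_sup_left := le_add_pos_right
  le_sup_right := le_add_pos_left
  sup_le _ _ _ := add_pos_le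
  inf f g := -(-g + pos (-f - -g))
  inf_le_left f g := neg_le.1 (le_add_pos_right (-f) (-g))
  inf_le_right f g := neg_le.1 (le_add_pos_left (-f) (-g))
  le_inf _ _ _ hf hg := le_neg.1 (add_pos_le (neg_le_neg hf) (neg_le_neg hg))

theorem abs_apply_le (f : StrongDual ℝ E) (x : E) : |f x| ≤ |f| |x| := by
  have key : ∀ y : E, f y ≤ |f| |y| := fun y => by
    have h1 : f y⁺ ≤ |f| y⁺ := le_abs_self f _ (posPart_nonneg y)
    have h2 : (-f) y⁻ ≤ |f| y⁻ := neg_le_abs f _ (negPart_nonneg y)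
    have h3 : f y = f y⁺ - f y⁻ := by rw [← map_sub, posPart_sub_negPart]
    have h4 : |f| |y| = |f| y⁺ + |f| y⁻ := by rw [← map_add, posPart_add_negPart]
    rw [neg_apply] at h2
    linarith
  refine abs_le'.2 ⟨key x, ?_⟩
  simpa using key (-x)

theorem abs_apply_abs_le (f : StrongDual ℝ E) (x : E) : |f| |x| ≤ ‖f‖ * ‖x‖ := by
  change (-f + pos (f - -f)) |x| ≤ _
  rw [add_apply, pos_apply _ (abs_nonneg x), ← le_sub_iff_add_le']
  refine posValue_le (abs_nonneg x) fun y hy => ?_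
  have h : |y + y - (|x|)| ≤ |x| := by
    rw [abs_le']
    constructor
    · rw [sub_le_iff_le_add]
      exact add_le_add hy.2 hy.2
    · rw [neg_sub]
      exact sub_le_self _ (add_nonneg hy.1 hy.1)
  have := apply_le_norm_mul (f := f) h
  simp only [map_sub, map_add, sub_neg_eq_add, add_apply,
    neg_apply] at this ⊢
  linarith

instance instHasSolidNorm : HasSolidNorm (StrongDual ℝ E) where
  solid f g h := f.opNorm_le_bound (norm_nonneg g) fun x =>
    (abs_apply_le f x).trans ((h _ (abs_nonneg x)).trans (abs_apply_abs_le g x))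

end BanachLatticeDual

/-! ### Notions for Banach spaces -/

section BanachSpace

variable {X : Type u} [NormedAddCommGroup X] [NormedSpace ℝ X]
  {Y : Type v} [NormedAddCommGroup Y] [NormedSpace ℝ Y]

/-- The sequence `x` converges weakly to `0`. -/
def IsWeaklyNull (x : ℕ → X) : Prop :=
  Tendsto (fun n => toWeakSpace ℝ X (x n)) atTop (𝓝 0)

/-- A bounded set `A ⊆ X'` is an (L)-set if `sup_{f ∈ A} |f (x n)| → 0` for every weakly null
sequence `x` in `X`. -/
def IsLSet (A : Set (StrongDual ℝ X)) : Prop :=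
  Bornology.IsBounded A ∧
    ∀ x : ℕ → X, IsWeaklyNull x → Tendsto (fun n => ⨆ f : A, |f.1 (x n)|) atTop (𝓝 0)

/-- A Dunford-Pettis operator maps weakly null sequences to norm null sequences. -/
def IsDunfordPettis (T : X →L[ℝ] Y) : Prop :=
  ∀ x : ℕ → X, IsWeaklyNull x → Tendsto (fun n => ‖T (x n)‖) atTop (𝓝 0)

end BanachSpace

/-! ### Notions for Banach lattices -/

section BanachLattice

variable {E : Type u} [NormedAddCommGroup E] [NormedSpace ℝ E] [Lattice E]
  {Y : Type v} [NormedAddCommGroup Y] [NormedSpace ℝ Y]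

/-- `E` is order continuous: every net decreasing to `0` is norm null.  (A monotone net may be
replaced by the directed set of its values, so index types in the universe of `E` are enough.) -/
def IsOrderContinuous (E : Type u) [NormedAddCommGroup E] [Lattice E] : Prop :=
  ∀ (ι : Type u) [Preorder ι] [IsDirectedOrder ι] [Nonempty ι] (x : ι → E),
    Antitone x → IsGLB (Set.range x) 0 → Tendsto (fun i => ‖x i‖) atTop (𝓝 0)

/-- A nonempty bounded set `A` is L-weakly compact if every disjoint sequence in its solid hull is
norm null. -/
def IsLWeaklyCompact {E : Type u} [NormedAddCommGroup E] [Lattice E] (A : Set E) : Prop :=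
  A.Nonempty ∧ Bornology.IsBounded A ∧
    ∀ x : ℕ → E, (∀ n, x n ∈ LatticeOrderedAddCommGroup.solidClosure A) →
      (Pairwise fun m n => |x m| ⊓ |x n| = 0) → Tendsto (fun n => ‖x n‖) atTop (𝓝 0)

/-- The sequence `x` is uaw-convergent to `0`: `|x n| ⊓ w → 0` weakly for every `w ≥ 0`. -/
def IsUAWNull (x : ℕ → E) : Prop :=
  ∀ w : E, 0 ≤ w → IsWeaklyNull fun n => |x n| ⊓ w

/-- A uaw-Dunford-Pettis operator maps norm bounded uaw-null sequences to norm null sequences. -/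
def IsUAWDunfordPettis (T : E →L[ℝ] Y) : Prop :=
  ∀ x : ℕ → E, Bornology.IsBounded (Set.range x) → IsUAWNull x →
    Tendsto (fun n => ‖T (x n)‖) atTop (𝓝 0)

end BanachLattice

/-! ### Disjointness in lattice-ordered groups -/

section LatticeGroup

variable {α : Type*} [AddCommGroup α] [Lattice α] [IsOrderedAddMonoid α]

/-! All three conditions are equivalent to a fourth: norm bounded disjoint sequences in `E` are
weakly null (`DisjointSequencesWeaklyNull`).

To derive it, a positive functional `f` is split along a disjoint sequence `x n` into disjoint
components `g n ≤ f` with `g n |x n| = f |x n|` (`StrongDual.exists_disjoint_components`), so `‖g n‖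
→ 0` suffices. Order continuity gives this because the tails of `∑ g n` decrease to `0`; the (L)-set
condition gives it because `{f}` is an (L)-set. For the operator condition, a functional is itself a
Dunford-Pettis operator, and disjoint sequences are uaw-null.

To use it, `exists_forall_posPart_sub_le` yields a single `w ≥ 0` with `p (x - w)⁺` uniformly small
on the positive part of a ball. Taking for `p` a functional, the supremum of `|f| |x|` over an
(L)-set, or `‖T x‖`, reduces each norm estimate to the order interval `[0, w]`. There the decreasing
net converges pointwise, and uaw-null sequences truncated at `w` are weakly null; for (L)-sets the
missing fact is that disjoint functionals in the solid hull tend to `0` at `w`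
(`tendsto_apply_of_disjoint`). -/

theorem add_inf_le_inf_add_inf {a b c : α} (ha : 0 ≤ a) (hb : 0 ≤ b) (hc : 0 ≤ c) :
    (a + b) ⊓ c ≤ a ⊓ c + b ⊓ c := by
  rw [add_inf, inf_add, inf_add]
  exact le_inf (le_inf inf_le_left (inf_le_right.trans (le_add_of_nonneg_right hb)))
    (le_inf (inf_le_right.trans (le_add_of_nonneg_left ha))
      (inf_le_right.trans (le_add_of_nonneg_left hc)))

theorem add_inf_eq_zero {a b c : α} (ha : 0 ≤ a) (hb : 0 ≤ b) (hc : 0 ≤ c) (hac : a ⊓ c = 0)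
    (hbc : b ⊓ c = 0) : (a + b) ⊓ c = 0 :=
  le_antisymm ((add_inf_le_inf_add_inf ha hb hc).trans (by rw [hac, hbc, add_zero]))
    (le_inf (add_nonneg ha hb) hc)

theorem sum_inf_eq_zero {ι : Type*} (s : Finset ι) {x : ι → α} {c : α} (hx : ∀ i, 0 ≤ x i)
    (hc : 0 ≤ c) (h : ∀ i ∈ s, x i ⊓ c = 0) : (∑ i ∈ s, x i) ⊓ c = 0 := by
  classical
  induction s using Finset.induction_on with
  | empty => simpa using hc
  | insert a s ha ih =>
    rw [Finset.sum_insert ha]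
    exact add_inf_eq_zero (hx a) (Finset.sum_nonneg fun i _ => hx i) hc (h a (by simp))
      (ih fun i hi => h i (by simp [hi]))

theorem sum_le_of_disjoint {ι : Type*} (s : Finset ι) {x : ι → α} {w : α} (hx : ∀ i, 0 ≤ x i)
    (hw : 0 ≤ w) (hle : ∀ i, x i ≤ w) (h : Pairwise fun i j => x i ⊓ x j = 0) :
    ∑ i ∈ s, x i ≤ w := by
  classical
  induction s using Finset.induction_on with
  | empty => simpa using hw
  | insert a s ha ih =>
    -- Disjointness turns the sum into a supremum.
    rw [Finset.sum_insert ha, ← inf_add_sup (x a), inf_comm, sum_inf_eq_zero s hx (hx a), zero_add]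
    · exact sup_le (hle a) ih
    · exact fun i hi => h (ne_of_mem_of_not_mem hi ha)

theorem nsmul_inf_eq_zero {a c : α} (ha : 0 ≤ a) (hc : 0 ≤ c) (h : a ⊓ c = 0) (k : ℕ) :
    (k • a) ⊓ c = 0 := by
  simpa using sum_inf_eq_zero (Finset.range k) (x := fun _ => a) (fun _ => ha) hc fun _ _ => h

omit [IsOrderedAddMonoid α] in
theorem inf_eq_zero_of_le {a b c d : α} (ha : 0 ≤ a) (hb : 0 ≤ b) (hac : a ≤ c) (hbd : b ≤ d)
    (h : c ⊓ d = 0) : a ⊓ b = 0 :=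
  le_antisymm (h ▸ inf_le_inf hac hbd) (le_inf ha hb)

theorem posPart_sub_inf_posPart_sub (a b : α) : (a - b)⁺ ⊓ (b - a)⁺ = 0 := by
  rw [← neg_sub a b, posPart_neg, posPart_inf_negPart_eq_zero]

theorem inf_add_posPart_sub (a b : α) : a ⊓ b + (a - b)⁺ = a := by
  rw [inf_eq_sub_posPart_sub, sub_add_cancel]

theorem inf_posPart_abs_le {x w : α} (hw : 0 ≤ w) : |x⁺ ⊓ w| ≤ |x| ⊓ w := by
  rw [abs_of_nonneg (le_inf (posPart_nonneg x) hw)]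
  exact inf_le_inf_right _ (sup_le (le_abs_self x) (abs_nonneg x))

end LatticeGroup

/-! ### Weakly null sequences in Banach lattices -/

theorem isWeaklyNull_iff {X : Type u} [NormedAddCommGroup X] [NormedSpace ℝ X] {x : ℕ → X} :
    IsWeaklyNull x ↔ ∀ f : StrongDual ℝ X, Tendsto (fun n => f (x n)) atTop (𝓝 0) := by
  unfold IsWeaklyNull
  have := WeakBilin.tendsto_iff_forall_eval_tendsto (𝕜 := ℝ) (l := (atTop : Filter ℕ))
    (f := fun n => toWeakSpace ℝ X (x n)) (x := 0) (B := (topDualPairing ℝ X).flip)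
    -- The pairing separates points, by Hahn-Banach.
    (by
      intro a b h
      by_contra hne
      obtain ⟨f, -, hf⟩ := exists_dual_vector ℝ (a - b) (norm_ne_zero_iff.2 (sub_ne_zero.2 hne))
      have h' : f a = f b := DFunLike.congr_fun h f
      rw [map_sub, h', sub_self] at hf
      exact hne (sub_eq_zero.1 (norm_eq_zero.1 (by exact_mod_cast hf.symm))))
  refine this.trans (forall_congr' fun f => ?_)
  have h0 : ((topDualPairing ℝ X).flip 0) f = 0 := by simp
  exact h0 ▸ Iff.rfl

section BanachLattice

variable {E : Type u} [NormedAddCommGroup E] [NormedSpace ℝ E] [Lattice E]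
  [IsOrderedAddMonoid E] [HasSolidNorm E]

open BanachLatticeDual

omit [HasSolidNorm E] in
theorem StrongDual.monotone_of_nonneg {f : StrongDual ℝ E} (hf : 0 ≤ f) {x y : E} (h : x ≤ y) :
    f x ≤ f y := by
  have : 0 ≤ f (y - x) := hf _ (sub_nonneg.2 h)
  rwa [map_sub, sub_nonneg] at this

omit [HasSolidNorm E] in
theorem apply_le_apply_add_apply_posPart_sub {f : StrongDual ℝ E} (hf : 0 ≤ f) (x w : E) :
    f x ≤ f w + f (x - w)⁺ := by
  rw [← map_add]
  refine StrongDual.monotone_of_nonneg hf ?_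
  exact sub_le_iff_le_add'.1 (le_posPart _)

theorem StrongDual.abs_apply_le_of_abs_le (f : StrongDual ℝ E) {x y : E} (h : |x| ≤ y) :
    |f x| ≤ |f| y :=
  (abs_apply_le f x).trans (StrongDual.monotone_of_nonneg (abs_nonneg f) h)

theorem isWeaklyNull_of_abs_le {x y : ℕ → E} (hy : IsWeaklyNull y) (h : ∀ n, |x n| ≤ y n) :
    IsWeaklyNull x := by
  rw [isWeaklyNull_iff] at hy ⊢
  exact fun f => squeeze_zero_norm (fun n => f.abs_apply_le_of_abs_le (h n)) (hy |f|)

theorem isWeaklyNull_of_nonneg {x : ℕ → E} (hx : ∀ n, 0 ≤ x n)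
    (h : ∀ f : StrongDual ℝ E, 0 ≤ f → Tendsto (fun n => f (x n)) atTop (𝓝 0)) :
    IsWeaklyNull x := by
  rw [isWeaklyNull_iff]
  exact fun f => squeeze_zero_norm (fun n => f.abs_apply_le_of_abs_le (abs_of_nonneg (hx n)).le)
    (h |f| (abs_nonneg f))

/-- A positive sequence with order bounded partial sums is weakly null. -/
theorem isWeaklyNull_of_sum_le {x : ℕ → E} {w : E} (hx : ∀ n, 0 ≤ x n)
    (h : ∀ n, ∑ i ∈ Finset.range n, x i ≤ w) : IsWeaklyNull x := by
  refine isWeaklyNull_of_nonneg hx fun f hf => ?_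
  refine (summable_of_sum_range_le (f := fun n => f (x n)) (c := f w)
    (fun n => hf _ (hx n)) fun n => ?_).tendsto_atTop_zero
  rw [← map_sum]
  exact StrongDual.monotone_of_nonneg hf (h n)

/-- Disjoint sequences are uaw-null. -/
theorem isUAWNull_of_disjoint {x : ℕ → E} (h : Pairwise fun m n => |x m| ⊓ |x n| = 0) :
    IsUAWNull x := fun w hw => by
  have h0 : ∀ n, 0 ≤ |x n| ⊓ w := fun n => le_inf (abs_nonneg _) hw
  refine isWeaklyNull_of_sum_le (w := w) h0 fun n => ?_
  exact sum_le_of_disjoint _ h0 hw (fun _ => inf_le_right) fun m n hmn =>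
    inf_eq_zero_of_le (h0 m) (h0 n) inf_le_left inf_le_left (h hmn)

end BanachLattice

/-! ### Disjointification and almost order bounded balls -/

section Disjointification

variable {E : Type u} [NormedAddCommGroup E] [NormedSpace ℝ E] [Lattice E]
  [IsOrderedAddMonoid E] [IsOrderedModule ℝ E] [HasSolidNorm E]

omit [HasSolidNorm E] in
theorem posPart_sub_inv_smul_inf {a b : E} {r : ℝ} (hr : 1 ≤ r) :
    (a - r⁻¹ • b)⁺ ⊓ (b - r • a)⁺ = 0 := by
  have h0 : 0 ≤ (r • a - b)⁺ := posPart_nonneg _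
  have hr0 : 0 < r := zero_lt_one.trans_le hr
  refine inf_eq_zero_of_le (posPart_nonneg _) (posPart_nonneg _) (sup_le ?_ h0) le_rfl
    (posPart_sub_inf_posPart_sub (r • a) b)
  calc a - r⁻¹ • b = r⁻¹ • (r • a - b) := by rw [smul_sub, inv_smul_smul₀ hr0.ne']
    _ ≤ r⁻¹ • (r • a - b)⁺ := smul_le_smul_of_nonneg_left (le_posPart _) (inv_nonneg.2 hr0.le)
    _ ≤ (1 : ℝ) • (r • a - b)⁺ := smul_le_smul_of_nonneg_right (inv_le_one_of_one_le₀ hr) h0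
    _ = (r • a - b)⁺ := one_smul _ _

/-- If `p` tends to `0` along the disjoint positive sequences of a ball, then the positive part of
the ball is, up to a set where `p` is small, an order interval. -/
theorem exists_forall_posPart_sub_le [CompleteSpace E] {p : E → ℝ} {C R : ℝ}
    (hp : ∀ x y, p x - p y ≤ C * ‖x - y‖)
    (hd : ∀ z : ℕ → E, (∀ n, 0 ≤ z n) → (∀ n, ‖z n‖ ≤ R) →
      (Pairwise fun m n => z m ⊓ z n = 0) → Tendsto (fun n => p (z n)) atTop (𝓝 0))
    {ε : ℝ} (hε : 0 < ε) :
    ∃ w : E, 0 ≤ w ∧ ∀ x : E, 0 ≤ x → ‖x‖ ≤ R → p (x - w)⁺ ≤ ε := by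
  by_contra! hcon
  choose! F hF0 hF1 hFε using hcon
  -- `x n` is a counterexample to the choice `w = 4 ^ n • (x 0 + ⋯ + x (n - 1))`.
  let S : ℕ → E := Nat.rec 0 fun n s => s + F ((4 : ℝ) ^ n • s)
  let x : ℕ → E := fun n => F ((4 : ℝ) ^ n • S n)
  have hSsucc : ∀ n, S (n + 1) = S n + x n := fun n => rfl
  have hS0 : ∀ n, 0 ≤ S n := by
    intro n
    induction n with
    | zero => exact le_rfl
    | succ n ih => exact add_nonneg ih (hF0 _ (smul_nonneg (by positivity) ih))
  have hw0 : ∀ n, 0 ≤ (4 : ℝ) ^ n • S n := fun n => smul_nonneg (by positivity) (hS0 n)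
  have hx0 : ∀ n, 0 ≤ x n := fun n => hF0 _ (hw0 n)
  have hx1 : ∀ n, ‖x n‖ ≤ R := fun n => hF1 _ (hw0 n)
  have hSmono : Monotone S := monotone_nat_of_le_succ fun n => by
    rw [hSsucc]; exact le_add_of_nonneg_right (hx0 n)
  have hxS : ∀ n m, n < m → x n ≤ S m := fun n m h =>
    (le_add_of_nonneg_left (hS0 n)).trans ((hSsucc n).symm.le.trans (hSmono h))
  have hsum : Summable fun n => (1 / 2 : ℝ) ^ n • x n := by
    refine Summable.of_norm_bounded (summable_geometric_two.mul_right R) fun n => ?_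
    rw [norm_smul, norm_pow, Real.norm_of_nonneg (by norm_num : (0 : ℝ) ≤ 1 / 2)]
    exact mul_le_mul_of_nonneg_left (hx1 n) (by positivity)
  set X := ∑' n, (1 / 2 : ℝ) ^ n • x n with hX
  have hle : ∀ n, (1 / 2 : ℝ) ^ n • x n ≤ X := fun n =>
    hsum.le_tsum n fun m _ => smul_nonneg (by positivity) (hx0 m)
  have hX0 : 0 ≤ X := (smul_nonneg (by positivity) (hx0 0)).trans (hle 0)
  -- Subtracting `4 ^ n • S n` separates `x n` from earlier terms; the vanishing correction by `X`
  -- separates it from later ones.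
  let z : ℕ → E := fun n => (x n - (4 : ℝ) ^ n • S n - (1 / 2 : ℝ) ^ n • X)⁺
  have hz0 : ∀ n, 0 ≤ z n := fun n => posPart_nonneg _
  have hX' : ∀ n, 0 ≤ (1 / 2 : ℝ) ^ n • X := fun n => smul_nonneg (by positivity) hX0
  have hzx : ∀ n, z n ≤ x n := fun n =>
    sup_le ((sub_le_self _ (hX' n)).trans (sub_le_self _ (hw0 n))) (hx0 n)
  have hz1 : ∀ n, ‖z n‖ ≤ R := fun n =>
    (norm_le_norm_of_abs_le_abs (by
      rw [abs_of_nonneg (hz0 n), abs_of_nonneg (hx0 n)]; exact hzx n)).trans (hx1 n)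
  have hlt : ∀ n m, n < m → z n ⊓ z m = 0 := fun n m h => by
    refine inf_eq_zero_of_le (hz0 n) (hz0 m) (posPart_mono ?_) (posPart_mono ?_)
      (posPart_sub_inv_smul_inf (a := x n) (b := x m) (r := (4 : ℝ) ^ m)
        (one_le_pow₀ (by norm_num)))
    · refine sub_le_sub (sub_le_self _ (hw0 n)) ?_
      calc ((4 : ℝ) ^ m)⁻¹ • x m ≤ ((1 / 2 : ℝ) ^ n * (1 / 2) ^ m) • x m := by
            refine smul_le_smul_of_nonneg_right ?_ (hx0 m)
            calc ((4 : ℝ) ^ m)⁻¹ = (1 / 2) ^ m * (1 / 2) ^ m := by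
                  rw [← mul_pow, ← inv_pow]; norm_num
              _ ≤ _ := mul_le_mul_of_nonneg_right
                  (pow_le_pow_of_le_one (by norm_num) (by norm_num) h.le) (by positivity)
        _ = (1 / 2 : ℝ) ^ n • (1 / 2 : ℝ) ^ m • x m := mul_smul _ _ _
        _ ≤ (1 / 2 : ℝ) ^ n • X := smul_le_smul_of_nonneg_left (hle m) (by positivity)
    · exact (sub_le_self _ (hX' m)).trans
        (sub_le_sub_left (smul_le_smul_of_nonneg_left (hxS n m h) (by positivity)) _)
  have hlim := hd z hz0 hz1 fun m n hmn => by
    rcases hmn.lt_or_gt with h | h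
    · exact hlt m n h
    · rw [inf_comm]; exact hlt n m h
  have hlim' : Tendsto (fun n => p (z n) + C * ((1 / 2 : ℝ) ^ n * ‖X‖)) atTop (𝓝 0) := by
    simpa using hlim.add (((tendsto_pow_atTop_nhds_zero_of_lt_one (r := (1 / 2 : ℝ))
      (by norm_num) (by norm_num)).mul_const ‖X‖).const_mul C)
  refine absurd (ge_of_tendsto' hlim' fun n => ?_) (not_le.2 hε)
  refine (hFε _ (hw0 n)).le.trans ?_
  -- The Lipschitz hypothesis allows `C < 0` only when every norm is zero.
  have hC : 0 ≤ C ∨ ∀ y : E, ‖y‖ = 0 := by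
    by_contra! h
    obtain ⟨hC, y, hy⟩ := h
    have h1 := hp y 0
    have h2 := hp 0 y
    rw [sub_zero] at h1
    rw [zero_sub, norm_neg] at h2
    have h3 : C * ‖y‖ < 0 := mul_neg_of_neg_of_pos hC ((norm_nonneg y).lt_of_ne' hy)
    linarith
  have h1 := hp (x n - (4 : ℝ) ^ n • S n)⁺ (z n)
  have h2 : ‖(x n - (4 : ℝ) ^ n • S n)⁺ - z n‖ ≤ (1 / 2 : ℝ) ^ n * ‖X‖ := by
    refine (lipschitzWith_posPart.norm_sub_le _ _).trans (le_of_eq ?_)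
    rw [sub_sub_cancel, norm_smul, norm_pow, Real.norm_of_nonneg (by norm_num : (0 : ℝ) ≤ 1 / 2)]
    simp
  rcases hC with hC | hC
  · have := mul_le_mul_of_nonneg_left h2 hC
    change p (x n - (4 : ℝ) ^ n • S n)⁺ ≤ _
    linarith
  · rw [hC] at h1
    rw [hC X]
    change p (x n - (4 : ℝ) ^ n • S n)⁺ ≤ _
    linarith

end Disjointification

/-! ### Components and disjointness of functionals -/

section Functionals

variable {E : Type u} [NormedAddCommGroup E] [NormedSpace ℝ E] [Lattice E]
  [IsOrderedAddMonoid E] [HasSolidNorm E]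

open BanachLatticeDual

/-- A function that is additive on the positive cone and dominated there by a positive functional
extends to a positive functional. -/
theorem StrongDual.exists_eq_on_nonneg {φ : E → ℝ} (f : StrongDual ℝ E)
    (hadd : ∀ x y, 0 ≤ x → 0 ≤ y → φ (x + y) = φ x + φ y)
    (h0 : ∀ x, 0 ≤ x → 0 ≤ φ x) (hle : ∀ x, 0 ≤ x → φ x ≤ f x) :
    ∃ g : StrongDual ℝ E, ∀ x, 0 ≤ x → g x = φ x := by
  have hsub : ∀ a b, 0 ≤ a → 0 ≤ b → φ (a - b)⁺ - φ (a - b)⁻ = φ a - φ b := fun a b ha hb => by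
    have h : (a - b)⁺ + b = (a - b)⁻ + a := by
      have := posPart_sub_negPart (a - b)
      rw [sub_eq_sub_iff_add_eq_add] at this
      rw [this, add_comm]
    have h' := congrArg φ h
    rw [hadd _ _ (posPart_nonneg _) hb, hadd _ _ (negPart_nonneg _) ha] at h'
    linarith
  let A : E →+ ℝ := AddMonoidHom.mk' (fun x => φ x⁺ - φ x⁻) fun x y => by
    have h : x + y = (x⁺ + y⁺) - (x⁻ + y⁻) := by
      nth_rw 1 [← posPart_sub_negPart x, ← posPart_sub_negPart y]
      abel
    have hx := posPart_nonneg x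
    have hy := posPart_nonneg y
    have hx' := negPart_nonneg x
    have hy' := negPart_nonneg y
    rw [h, hsub _ _ (add_nonneg hx hy) (add_nonneg hx' hy'), hadd _ _ hx hy, hadd _ _ hx' hy']
    abel
  have hA : ∀ x, ‖A x‖ ≤ ‖f‖ * ‖x‖ := fun x => by
    change |φ x⁺ - φ x⁻| ≤ _
    have h1 := h0 _ (posPart_nonneg x)
    have h2 := h0 _ (negPart_nonneg x)
    have h3 := hle _ (posPart_nonneg x)
    have h4 := hle _ (negPart_nonneg x)
    have h5 : f x⁺ + f x⁻ ≤ ‖f‖ * ‖x‖ := by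
      rw [← map_add, posPart_add_negPart]
      exact apply_le_norm_mul (abs_abs x).le
    rw [abs_le]
    constructor <;> linarith
  refine ⟨A.toRealLinearMap (AddMonoidHomClass.continuous_of_bound A ‖f‖ hA), fun x hx => ?_⟩
  have hz : φ 0 = 0 := by
    have := hadd 0 0 le_rfl le_rfl
    rw [add_zero] at this
    linarith
  change φ x⁺ - φ x⁻ = φ x
  have := hsub x 0 hx le_rfl
  rwa [sub_zero, hz, sub_zero] at this

/-- The component of a positive functional carried by a positive element. -/
theorem StrongDual.exists_component {f : StrongDual ℝ E} (hf : 0 ≤ f) {y : E} (hy : 0 ≤ y) :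
    ∃ g : StrongDual ℝ E, 0 ≤ g ∧ g ≤ f ∧ g y = f y ∧ (∀ x, 0 ≤ x → x ⊓ y = 0 → g x = 0) ∧
      ∀ x, 0 ≤ x → Tendsto (fun k : ℕ => g (x - x ⊓ k • y)) atTop (𝓝 0) := by
  -- This is the part of `f` concentrated on the ideal generated by `y`; the limit clause expresses
  -- that concentration.
  let φ : E → ℝ := fun x => ⨆ k : ℕ, f (x ⊓ k • y)
  have hky : ∀ k : ℕ, 0 ≤ k • y := fun k => nsmul_nonneg hy k
  have hbdd : ∀ x, BddAbove (Set.range fun k : ℕ => f (x ⊓ k • y)) := fun x =>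
    ⟨f x, by rintro _ ⟨k, rfl⟩; exact StrongDual.monotone_of_nonneg hf inf_le_left⟩
  have hlim : ∀ x, Tendsto (fun k : ℕ => f (x ⊓ k • y)) atTop (𝓝 (φ x)) := fun x =>
    tendsto_atTop_ciSup (fun k l hkl => StrongDual.monotone_of_nonneg hf
      (inf_le_inf_left _ (nsmul_le_nsmul_left hy hkl))) (hbdd x)
  have hφ0 : ∀ x, 0 ≤ x → 0 ≤ φ x := fun x hx =>
    ge_of_tendsto' (hlim x) fun k => hf _ (le_inf hx (hky k))
  have hφle : ∀ x, 0 ≤ x → φ x ≤ f x := fun x _ =>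
    ciSup_le fun k => StrongDual.monotone_of_nonneg hf inf_le_left
  obtain ⟨g, hg⟩ := StrongDual.exists_eq_on_nonneg (φ := φ) f (fun a b ha hb => by
    apply le_antisymm
    · refine le_of_tendsto_of_tendsto' (hlim (a + b)) ((hlim a).add (hlim b)) fun k => ?_
      rw [← map_add]
      exact StrongDual.monotone_of_nonneg hf (add_inf_le_inf_add_inf ha hb (hky k))
    · refine le_of_tendsto' ((hlim a).add (hlim b)) fun k => ?_
      rw [← map_add]
      -- Superadditivity costs a doubling: `a ⊓ ky + b ⊓ ky ≤ (a + b) ⊓ 2ky`.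
      refine le_trans ?_ (le_ciSup (hbdd (a + b)) (k + k))
      refine StrongDual.monotone_of_nonneg hf (le_inf (add_le_add inf_le_left inf_le_left) ?_)
      rw [add_nsmul]
      exact add_le_add inf_le_right inf_le_right) hφ0 hφle
  refine ⟨g, fun x hx => by simpa [hg x hx] using hφ0 x hx, fun x hx => by
    simpa [hg x hx] using hφle x hx, ?_, fun x hx hxy => ?_, fun x hx => ?_⟩
  · rw [hg y hy]
    refine le_antisymm (hφle y hy) (le_trans (le_of_eq ?_) (le_ciSup (hbdd y) 1))
    simp
  · rw [hg x hx]
    refine (iSup_congr fun k => ?_).trans (ciSup_const (a := (0 : ℝ)))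
    rw [inf_comm, nsmul_inf_eq_zero hy hx (by rw [inf_comm, hxy]), map_zero]
  · have h1 : ∀ k : ℕ, g (x - x ⊓ k • y) = φ x - f (x ⊓ k • y) := fun k => by
      rw [map_sub, hg x hx, hg _ (le_inf hx (hky k))]
      refine congrArg _ (le_antisymm (hφle _ (le_inf hx (hky k)))
        (le_trans (le_of_eq ?_) (le_ciSup (hbdd _) k)))
      simp
    simp only [h1]
    simpa using (hlim x).const_sub (φ x)

/-- Disjoint positive elements carry disjoint components of a positive functional. -/
theorem StrongDual.exists_disjoint_components {f : StrongDual ℝ E} (hf : 0 ≤ f) {y : ℕ → E}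
    (hy : ∀ n, 0 ≤ y n) (hd : Pairwise fun m n => y m ⊓ y n = 0) :
    ∃ g : ℕ → StrongDual ℝ E, (∀ n, 0 ≤ g n) ∧ (∀ n, g n ≤ f) ∧ (∀ n, g n (y n) = f (y n)) ∧
      Pairwise fun m n => g m ⊓ g n = 0 := by
  choose g hg0 hgf hgy hgd hgl using fun n => StrongDual.exists_component hf (hy n)
  refine ⟨g, hg0, hgf, hgy, fun m n hmn => ?_⟩
  refine le_antisymm (fun x hx => ?_) (le_inf (hg0 m) (hg0 n))
  -- Split `x` at `x ⊓ k • y m`: there `g n` vanishes, and on the remainder `g m` tends to `0`.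
  refine ge_of_tendsto' (hgl m x hx) fun k => ?_
  have hk : 0 ≤ x ⊓ k • y m := le_inf hx (nsmul_nonneg (hy m) k)
  have h1 : (g m ⊓ g n) (x - x ⊓ k • y m) ≤ g m (x - x ⊓ k • y m) :=
    (inf_le_left : g m ⊓ g n ≤ g m) _ (sub_nonneg.2 inf_le_left)
  have h2 : (g m ⊓ g n) (x ⊓ k • y m) ≤ g n (x ⊓ k • y m) :=
    (inf_le_right : g m ⊓ g n ≤ g n) _ hk
  have h3 : g n (x ⊓ k • y m) = 0 := hgd n _ hk
    (inf_eq_zero_of_le hk (hy n) inf_le_right le_rfl (nsmul_inf_eq_zero (hy m) (hy n) (hd hmn) k))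
  rw [map_sub] at h1
  linarith

/-- The modulus of a functional is attained approximately on order intervals. -/
theorem StrongDual.exists_abs_apply_lt (f : StrongDual ℝ E) {x : E} (hx : 0 ≤ x) {η : ℝ}
    (hη : 0 < η) : ∃ e : E, |e| ≤ x ∧ |f| x < f e + η := by
  have h1 : |f| x = -f x + posValue (f - -f) x := by
    change (-f + pos (f - -f)) x = _
    rw [add_apply, pos_apply _ hx, neg_apply]
  by_contra! hcon
  -- The map `y ↦ 2y - x` carries `[0, x]` into `[-x, x]`.
  have h2 : posValue (f - -f) x ≤ |f| x + f x - η := posValue_le hx fun y hy => by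
    have := hcon (y + y - x) (by
      rw [abs_le']
      refine ⟨sub_le_iff_le_add.2 (add_le_add hy.2 hy.2), ?_⟩
      rw [neg_sub]
      exact sub_le_self _ (add_nonneg hy.1 hy.1))
    simp only [map_sub, map_add, sub_neg_eq_add, add_apply] at this ⊢
    linarith
  linarith

/-- Disjoint positive functionals are carried approximately by complementary pieces of a positive
element. -/
theorem StrongDual.exists_apply_add_apply_sub_lt {f g : StrongDual ℝ E} (h : f ⊓ g = 0) {w : E}
    (hw : 0 ≤ w) {η : ℝ} (hη : 0 < η) :
    ∃ x : E, 0 ≤ x ∧ x ≤ w ∧ f x + g (w - x) < η := by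
  -- Disjointness means `(g - f)⁺ = g`; a near maximizer of `g - f` on `[0, w]` is the required `x`.
  have h1 : posValue (g - f) w = g w := by
    rw [← pos_apply _ hw]
    have h2 : g ⊔ f = g + f := by rw [← inf_add_sup g f, inf_comm, h, zero_add]
    change f + pos (g - f) = g + f at h2
    rw [add_comm g f, add_left_cancel_iff] at h2
    rw [h2]
  by_contra! hcon
  have h2 : posValue (g - f) w ≤ g w - η := posValue_le hw fun y hy => by
    have := hcon y hy.1 hy.2
    rw [map_sub] at this
    rw [sub_apply]
    linarith
  linarith

theorem StrongDual.norm_le_of_apply_le {f : StrongDual ℝ E} {c : ℝ} (hc : 0 ≤ c)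
    (h : ∀ x, 0 ≤ x → ‖x‖ ≤ 1 → |f| x ≤ c) : ‖f‖ ≤ c := by
  refine ContinuousLinearMap.opNorm_le_of_unit_norm hc fun x hx => ?_
  refine (abs_apply_le f x).trans (h _ (abs_nonneg x) ?_)
  rw [norm_abs_eq_norm, hx]

end Functionals

/-! ### Disjoint functionals at a fixed positive element -/

section MonotoneSequences

variable {E : Type u} [NormedAddCommGroup E] [Lattice E] [IsOrderedAddMonoid E]

/-- If `q` tends to `0` along positive sequences with partial sums bounded by `w`, then increasing
sequences bounded by `w` are Cauchy for `q`. -/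
theorem exists_forall_sub_le_of_monotone {q : E → ℝ} {w : E}
    (hq : ∀ d : ℕ → E, (∀ n, 0 ≤ d n) → (∀ n, ∑ i ∈ Finset.range n, d i ≤ w) →
      Tendsto (fun n => q (d n)) atTop (𝓝 0))
    {s : ℕ → E} (hs : Monotone s) (h0 : ∀ n, 0 ≤ s n) (hw : ∀ n, s n ≤ w) {ε : ℝ} (hε : 0 < ε) :
    ∃ N, ∀ m, N ≤ m → q (s m - s N) ≤ ε := by
  by_contra! hcon
  choose φ hφ hφε using hcon
  let t : ℕ → ℕ := Nat.rec 0 fun _ k => φ k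
  have hlim := hq (fun k => s (t (k + 1)) - s (t k)) (fun k => sub_nonneg.2 (hs (hφ (t k))))
    fun n => by
      rw [Finset.sum_range_sub fun k => s (t k)]
      exact (sub_le_self _ (h0 _)).trans (hw _)
  exact absurd (ge_of_tendsto' hlim fun k => (hφε (t k)).le) (not_le.2 hε)

theorem sum_range_mul_half_pow_le {ε : ℝ} (hε : 0 ≤ ε) (n k : ℕ) :
    ∑ j ∈ Finset.range k, ε * (1 / 2) ^ (n + 1 + j) ≤ ε * (1 / 2) ^ n := by
  have h := Summable.sum_le_tsum (Finset.range k) (fun j _ => by positivity)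
    (summable_geometric_two)
  rw [tsum_geometric_two] at h
  calc ∑ j ∈ Finset.range k, ε * (1 / 2 : ℝ) ^ (n + 1 + j)
      = ε * (1 / 2) ^ (n + 1) * ∑ j ∈ Finset.range k, (1 / 2 : ℝ) ^ j := by
        rw [Finset.mul_sum]
        exact Finset.sum_congr rfl fun j _ => by rw [pow_add _ (n + 1)]; ring
    _ ≤ ε * (1 / 2) ^ (n + 1) * 2 := mul_le_mul_of_nonneg_left h (by positivity)
    _ = ε * (1 / 2) ^ n := by ring

variable [NormedSpace ℝ E] [HasSolidNorm E]

/-- Under the assumption of `exists_forall_sub_le_of_monotone`, a disjoint sequence of positive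
functionals dominated by `q` cannot be bounded away from `0` at `w`. -/
theorem not_forall_le_apply_of_disjoint {q : E → ℝ} {w : E} (hw : 0 ≤ w)
    (hq : ∀ d : ℕ → E, (∀ n, 0 ≤ d n) → (∀ n, ∑ i ∈ Finset.range n, d i ≤ w) →
      Tendsto (fun n => q (d n)) atTop (𝓝 0))
    {h : ℕ → StrongDual ℝ E} (h0 : ∀ n, 0 ≤ h n) (hd : Pairwise fun m n => h m ⊓ h n = 0)
    (hhq : ∀ n x, 0 ≤ x → h n x ≤ q x) {ε : ℝ} (hε : 0 < ε) : ¬ ∀ n, ε ≤ h n w := by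
  intro hle
  have hmono : ∀ n {x y : E}, x ≤ y → h n x ≤ h n y := fun n _ _ =>
    StrongDual.monotone_of_nonneg (h0 n)
  have hdis : ∀ n, (∑ i ∈ Finset.range n, h i) ⊓ h n = 0 := fun n =>
    sum_inf_eq_zero _ h0 (h0 n) fun i hi => hd (Finset.mem_range.1 hi).ne
  -- `u n` carries nearly all of `h n` and almost nothing of the earlier functionals.
  choose u hu0 huw hu using fun n => StrongDual.exists_apply_add_apply_sub_lt (hdis n) hw
    (η := ε * (1 / 2) ^ (n + 2)) (by positivity)
  have hun0 : ∀ n i, 0 ≤ h i (u n) := fun n i => by simpa using h0 i _ (hu0 n)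
  have hui : ∀ n i, i < n → h i (u n) ≤ ε * (1 / 2) ^ (n + 2) := fun n i hi => by
    have h1 : h i (u n) ≤ (∑ i ∈ Finset.range n, h i) (u n) := by
      rw [sum_apply]
      exact Finset.single_le_sum (f := fun i => h i (u n)) (fun j _ => hun0 n j)
        (Finset.mem_range.2 hi)
    have h2 : 0 ≤ h n (w - u n) := by simpa using h0 n _ (sub_nonneg.2 (huw n))
    linarith [hu n]
  have hun : ∀ n, h n w - ε * (1 / 2) ^ (n + 2) ≤ h n (u n) := fun n => by
    have h1 : 0 ≤ (∑ i ∈ Finset.range n, h i) (u n) := by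
      rw [sum_apply]
      exact Finset.sum_nonneg fun j _ => hun0 n j
    have h2 := hu n
    rw [map_sub] at h2
    linarith
  -- Finite suprema stand in for the tail suprema of `u`, which need not exist in `E`; `N n` stops
  -- each where its later growth is negligible for `q`.
  let z : ℕ → ℕ → E := fun n k => partialSups (fun j => u (n + j)) k
  have hz0 : ∀ n k, 0 ≤ z n k := fun n k =>
    (hu0 (n + k)).trans (le_partialSups (fun j => u (n + j)) k)
  have hzw : ∀ n k, z n k ≤ w := fun n k => partialSups_le _ _ _ fun j _ => huw (n + j)
  have hzsmall : ∀ n k i, i < n → h i (z n k) ≤ ε * (1 / 2) ^ (n + 1) := fun n k i hi => by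
    have h1 : z n k ≤ ∑ j ∈ Finset.range (k + 1), u (n + j) :=
      partialSups_le _ _ _ fun j hj => Finset.single_le_sum (f := fun j => u (n + j))
        (fun j _ => hu0 (n + j)) (Finset.mem_range.2 (Nat.lt_succ_of_le hj))
    refine (hmono i h1).trans ?_
    rw [map_sum]
    refine le_trans (Finset.sum_le_sum fun j _ => ?_)
      (sum_range_mul_half_pow_le hε.le (n + 1) (k + 1))
    refine (hui (n + j) i (by omega)).trans (le_of_eq ?_)
    congr 2
    omega
  choose N hN using fun n => exists_forall_sub_le_of_monotone hq
    (partialSups (fun j => u (n + j))).monotone (hz0 n) (hzw n)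
    (ε := ε * (1 / 2) ^ (2 + 1 + n)) (by positivity)
  let v : ℕ → E := fun n => w - z n (N n)
  have hv0 : ∀ n, 0 ≤ v n := fun n => sub_nonneg.2 (hzw _ _)
  let Y : ℕ → E := fun n => partialSups v n
  have hY0 : ∀ n, 0 ≤ Y n := fun n => (hv0 n).trans (le_partialSups v n)
  have hYw : ∀ n, Y n ≤ w := fun n => partialSups_le _ _ _ fun j _ => sub_le_self _ (hz0 _ _)
  -- Extending each stopped supremum until it includes `u n` costs `r i`. Hence `Y n` exceeds `w - u
  -- n` by at most `∑ r i`, and each of the two pieces contributes at most `ε / 4`.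
  have hYsmall : ∀ n, h n (Y n) ≤ ε / 2 := fun n => by
    let r : ℕ → E := fun i => z i (max (N i) (n - i)) - z i (N i)
    have hr0 : ∀ i, 0 ≤ r i := fun i =>
      sub_nonneg.2 ((partialSups (fun j => u (i + j))).monotone (le_max_left _ _))
    have h1 : Y n ≤ w - u n + ∑ i ∈ Finset.range (n + 1), r i := by
      refine partialSups_le _ _ _ fun i hi => ?_
      have h2 : r i ≤ ∑ i ∈ Finset.range (n + 1), r i :=
        Finset.single_le_sum (fun j _ => hr0 j) (Finset.mem_range.2 (Nat.lt_succ_of_le hi))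
      have h3 : u n ≤ z i (max (N i) (n - i)) := by
        have := le_partialSups_of_le (fun j => u (i + j)) (le_max_right (N i) (n - i))
        rwa [Nat.add_sub_cancel' hi] at this
      calc v i = w - z i (max (N i) (n - i)) + r i := by simp only [v, r]; abel
        _ ≤ _ := add_le_add (sub_le_sub_left h3 w) h2
    have h4 := hmono n h1
    rw [map_add, map_sub, map_sum] at h4
    have h5 : ∑ i ∈ Finset.range (n + 1), h n (r i) ≤ ε * (1 / 2) ^ 2 :=
      (Finset.sum_le_sum fun i _ => (hhq n _ (hr0 i)).trans (hN i _ (le_max_left _ _))).trans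
        (sum_range_mul_half_pow_le hε.le 2 (n + 1))
    have h6 : ε * (1 / 2 : ℝ) ^ (n + 2) ≤ ε * (1 / 2) ^ 2 := mul_le_mul_of_nonneg_left
      (pow_le_pow_of_le_one (by norm_num) (by norm_num) (by omega)) hε.le
    linarith [hun n]
  -- Contradiction: `h K` is at most `ε / 2` at `Y K` and at least `3ε / 4` at `Y (K + 1)`, yet it
  -- may grow only by `ε / 8`.
  obtain ⟨K, hK⟩ := exists_forall_sub_le_of_monotone hq (partialSups v).monotone hY0 hYw
    (ε := ε / 8) (by positivity)
  have h1 : h K (Y (K + 1)) - h K (Y K) ≤ ε / 8 := by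
    rw [← map_sub]
    exact (hhq K _ (sub_nonneg.2 ((partialSups v).monotone K.le_succ))).trans (hK _ K.le_succ)
  have h2 : h K w - h K (z (K + 1) (N (K + 1))) ≤ h K (Y (K + 1)) := by
    rw [← map_sub]
    exact hmono K (le_partialSups v (K + 1))
  have h3 : ε * (1 / 2 : ℝ) ^ (K + 1 + 1) ≤ ε * (1 / 2) ^ 2 := mul_le_mul_of_nonneg_left
    (pow_le_pow_of_le_one (by norm_num) (by norm_num) (by omega)) hε.le
  linarith [hzsmall (K + 1) (N (K + 1)) K K.lt_succ_self, hYsmall K, hle K]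

theorem tendsto_apply_of_disjoint {q : E → ℝ} {w : E} (hw : 0 ≤ w)
    (hq : ∀ d : ℕ → E, (∀ n, 0 ≤ d n) → (∀ n, ∑ i ∈ Finset.range n, d i ≤ w) →
      Tendsto (fun n => q (d n)) atTop (𝓝 0))
    {h : ℕ → StrongDual ℝ E} (h0 : ∀ n, 0 ≤ h n) (hd : Pairwise fun m n => h m ⊓ h n = 0)
    (hhq : ∀ n x, 0 ≤ x → h n x ≤ q x) : Tendsto (fun n => h n w) atTop (𝓝 0) := by
  refine tendsto_order.2 ⟨fun a ha => Eventually.of_forall fun n => ha.trans_le (h0 n w hw),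
    fun ε hε => ?_⟩
  by_contra hcon
  obtain ⟨φ, hφ, hφε⟩ := extraction_of_frequently_atTop (not_eventually.1 hcon)
  exact not_forall_le_apply_of_disjoint hw hq (fun n => h0 (φ n))
    (fun m n hmn => hd (hφ.injective.ne hmn)) (fun n => hhq (φ n)) hε fun n => not_lt.1 (hφε n)

end MonotoneSequences

/-! ### The lattice seminorm of an (L)-set -/

section LSet

open BanachLatticeDual

variable {E : Type u} [NormedAddCommGroup E] [NormedSpace ℝ E] [Lattice E]
  [IsOrderedAddMonoid E] [HasSolidNorm E]

/-- The lattice seminorm `x ↦ sup {|f| |x| : f ∈ A}` defined by a bounded set of functionals. -/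
noncomputable def absSup (A : Set (StrongDual ℝ E)) (x : E) : ℝ := ⨆ f : A, |f.1| |x|

theorem le_absSup {A : Set (StrongDual ℝ E)} {C : ℝ} (hC : ∀ f ∈ A, ‖f‖ ≤ C) {f : StrongDual ℝ E}
    (hf : f ∈ A) (x : E) : |f| |x| ≤ absSup A x :=
  le_ciSup (f := fun f : A => |f.1| |x|) ⟨C * ‖x‖, by
    rintro _ ⟨g, rfl⟩
    exact (abs_apply_abs_le g.1 x).trans
      (mul_le_mul_of_nonneg_right (hC _ g.2) (norm_nonneg x))⟩ ⟨f, hf⟩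

theorem absSup_sub_le {A : Set (StrongDual ℝ E)} (hA : A.Nonempty) {C : ℝ}
    (hC : ∀ f ∈ A, ‖f‖ ≤ C) (x y : E) : absSup A x - absSup A y ≤ C * ‖x - y‖ := by
  have := hA.to_subtype
  rw [sub_le_iff_le_add]
  refine ciSup_le fun f => ?_
  have h1 : |f.1| |x| ≤ |f.1| |x - y| + |f.1| |y| := by
    rw [← map_add]
    refine StrongDual.monotone_of_nonneg (abs_nonneg _) ?_
    simpa using abs_add_le (x - y) y
  have h2 := (abs_apply_abs_le f.1 (x - y)).trans
    (mul_le_mul_of_nonneg_right (hC _ f.2) (norm_nonneg _))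
  linarith [le_absSup hC f.2 y]

/-- The (L)-set property controls `|f (e n)|`, not `|f| (d n)`. Choosing `|e n| ≤ d n` that nearly
attains the modulus of a nearly optimal `f` bridges the gap, and `e` is weakly null by domination.
-/
theorem IsLSet.tendsto_absSup {A : Set (StrongDual ℝ E)} (hL : IsLSet A) (hA : A.Nonempty)
    {d : ℕ → E} (hd0 : ∀ n, 0 ≤ d n) (hd : IsWeaklyNull d) :
    Tendsto (fun n => absSup A (d n)) atTop (𝓝 0) := by
  have := hA.to_subtype
  obtain ⟨C, hC⟩ := hL.1.exists_norm_le
  have h1 : ∀ n : ℕ, ∃ e : E, |e| ≤ d n ∧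
      absSup A (d n) ≤ (⨆ f : A, |f.1 e|) + 2 * (1 / ((n : ℝ) + 1)) := fun n => by
    have hη : (0 : ℝ) < 1 / ((n : ℝ) + 1) := Nat.one_div_pos_of_nat
    obtain ⟨f, hf⟩ := exists_lt_of_lt_ciSup (sub_lt_self (absSup A (d n)) hη)
    rw [abs_of_nonneg (hd0 n)] at hf
    obtain ⟨e, he, hfe⟩ := f.1.exists_abs_apply_lt (hd0 n) hη
    refine ⟨e, he, ?_⟩
    have h2 : |f.1 e| ≤ ⨆ f : A, |f.1 e| := le_ciSup (f := fun f : A => |f.1 e|)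
      ⟨C * ‖e‖, by
        rintro _ ⟨g, rfl⟩
        exact (g.1.le_opNorm e).trans (mul_le_mul_of_nonneg_right (hC _ g.2) (norm_nonneg e))⟩ f
    linarith [le_abs_self (f.1 e)]
  choose e he hle using h1
  have h2 := (hL.2 e (isWeaklyNull_of_abs_le hd he)).add
    ((tendsto_one_div_add_atTop_nhds_zero_nat (𝕜 := ℝ)).const_mul 2)
  rw [mul_zero, add_zero] at h2
  obtain ⟨f, hf⟩ := hA
  exact squeeze_zero
    (fun n => (abs_nonneg f _ (abs_nonneg (d n))).trans (le_absSup hC hf (d n))) hle h2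

end LSet

/-! ### Equivalence with weak nullity of disjoint sequences -/

section Characterizations

open BanachLatticeDual

variable {E : Type u} [NormedAddCommGroup E] [NormedSpace ℝ E] [Lattice E]
  [IsOrderedAddMonoid E] [HasSolidNorm E]

/-- Norm bounded disjoint sequences are weakly null. -/
def DisjointSequencesWeaklyNull (E : Type u) [NormedAddCommGroup E] [NormedSpace ℝ E]
    [Lattice E] : Prop :=
  ∀ x : ℕ → E, Bornology.IsBounded (Set.range x) → (Pairwise fun m n => |x m| ⊓ |x n| = 0) →
    IsWeaklyNull x

/-- It suffices to consider positive functionals that split into disjoint functionals along the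
sequence. -/
theorem disjointSequencesWeaklyNull_of_components
    (h : ∀ (f : StrongDual ℝ E) (g : ℕ → StrongDual ℝ E), 0 ≤ f → (∀ n, 0 ≤ g n) →
      (∀ n, g n ≤ f) → (Pairwise fun m n => g m ⊓ g n = 0) →
      Tendsto (fun n => ‖g n‖) atTop (𝓝 0)) : DisjointSequencesWeaklyNull E := by
  intro x hx hd
  obtain ⟨C, hC⟩ := hx.exists_norm_le
  refine isWeaklyNull_of_abs_le (y := fun n => |x n|) ?_ fun n => le_rfl
  refine isWeaklyNull_of_nonneg (fun n => abs_nonneg _) fun f hf => ?_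
  obtain ⟨g, hg0, hgf, hgx, hgd⟩ :=
    StrongDual.exists_disjoint_components hf (fun n => abs_nonneg (x n)) hd
  refine squeeze_zero (g := fun n => ‖g n‖ * C) (fun n => hf _ (abs_nonneg _)) (fun n => ?_)
    (by simpa using (h f g hf hg0 hgf hgd).mul_const C)
  rw [← hgx n]
  refine (apply_le_norm_mul (abs_abs (x n)).le).trans
    (mul_le_mul_of_nonneg_left (hC _ ⟨n, rfl⟩) (norm_nonneg _))

theorem IsOrderContinuous.disjointSequencesWeaklyNull (h : IsOrderContinuous (StrongDual ℝ E)) :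
    DisjointSequencesWeaklyNull E := by
  refine disjointSequencesWeaklyNull_of_components fun f g hf hg0 hgf hgd => ?_
  have hg0' : ∀ n x, 0 ≤ x → 0 ≤ g n x := fun n x hx => by simpa using hg0 n x hx
  have hpart : ∀ n x, 0 ≤ x → ∑ i ∈ Finset.range n, g i x ≤ f x := fun n x hx => by
    rw [← sum_apply]
    exact sum_le_of_disjoint (Finset.range n) hg0 hf hgf hgd x hx
  have hsum : ∀ x, 0 ≤ x → Summable fun n => g n x := fun x hx =>
    summable_of_sum_range_le (fun n => hg0' n x hx) fun n => hpart n x hx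
  -- `s` is the pointwise sum of the `g n`; its tails `F n` decrease to `0` and dominate `g n`.
  obtain ⟨s, hs⟩ := StrongDual.exists_eq_on_nonneg (φ := fun x => ∑' n, g n x) f
    (fun x y hx hy => by simp only [map_add]; exact (hsum x hx).tsum_add (hsum y hy))
    (fun x hx => tsum_nonneg fun n => hg0' n x hx)
    (fun x hx => Real.tsum_le_of_sum_range_le (fun n => hg0' n x hx) fun n => hpart n x hx)
  let F : ℕ → StrongDual ℝ E := fun n => s - ∑ i ∈ Finset.range n, g i
  have hFapply : ∀ n x, 0 ≤ x → F n x = (∑' i, g i x) - ∑ i ∈ Finset.range n, g i x :=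
    fun n x hx => by simp only [F, sub_apply, hs x hx, sum_apply]
  have hF0 : ∀ n, 0 ≤ F n := fun n x hx => by
    rw [hFapply n x hx]
    exact sub_nonneg.2 ((hsum x hx).sum_le_tsum _ fun i _ => hg0' i x hx)
  have hFsucc : ∀ n, F (n + 1) = F n - g n := fun n => by
    simp only [F, Finset.sum_range_succ, sub_sub]
  have hFanti : Antitone F := antitone_nat_of_succ_le fun n => by
    rw [hFsucc]; exact sub_le_self _ (hg0 n)
  have hlim := h (ULift ℕ) (fun n => F n.down) (fun m n hmn => hFanti hmn) ⟨by
    rintro _ ⟨n, rfl⟩; exact hF0 _, fun b hb x hx => by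
      refine ge_of_tendsto' (x := (atTop : Filter ℕ)) (f := fun n => F n x) ?_
        fun n => hb ⟨⟨n⟩, rfl⟩ x hx
      simp only [hFapply _ x hx]
      simpa using (hsum x hx).hasSum.tendsto_sum_nat.const_sub (∑' i, g i x)⟩
  have hlim' : Tendsto (fun n => ‖F n‖) atTop (𝓝 0) := by
    have hup : Tendsto (ULift.up : ℕ → ULift.{u} ℕ) atTop atTop :=
      tendsto_atTop.2 fun b => (eventually_ge_atTop b.down).mono fun n hn => hn
    exact hlim.comp hup
  refine squeeze_zero (fun n => norm_nonneg _) (fun n => norm_le_norm_of_abs_le_abs ?_) hlim'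
  rw [abs_of_nonneg (hg0 n), abs_of_nonneg (hF0 n), ← sub_nonneg, ← hFsucc]
  exact hF0 _

theorem disjointSequencesWeaklyNull_of_isLWeaklyCompact
    (h : ∀ A : Set (StrongDual ℝ E), A.Nonempty → IsLSet A → IsLWeaklyCompact A) :
    DisjointSequencesWeaklyNull E := by
  refine disjointSequencesWeaklyNull_of_components fun f g hf hg0 hgf hgd => ?_
  refine (h {f} (Set.singleton_nonempty f) ⟨Bornology.isBounded_singleton, fun x hx => ?_⟩).2.2 g
    (fun n => ⟨f, rfl, ?_⟩) fun m n hmn => ?_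
  · have := (isWeaklyNull_iff.1 hx f).abs
    rw [abs_zero] at this
    exact this.congr fun n => (ciSup_unique (s := fun g : ({f} : Set _) => |g.1 (x n)|)).symm
  · rw [abs_of_nonneg (hg0 n), abs_of_nonneg hf]
    exact hgf n
  · simp only [abs_of_nonneg (hg0 _)]
    exact hgd hmn

theorem disjointSequencesWeaklyNull_of_isUAWDunfordPettis
    (h : ∀ (X : Type v) [NormedAddCommGroup X] [NormedSpace ℝ X] [CompleteSpace X]
        (T : E →L[ℝ] X), IsDunfordPettis T → IsUAWDunfordPettis T) :
    DisjointSequencesWeaklyNull E := by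
  intro x hx hd
  refine isWeaklyNull_iff.2 fun f => ?_
  -- `ULift` only places the scalar target in the universe of `X`.
  let T : E →L[ℝ] ULift.{v} ℝ :=
    (ContinuousLinearEquiv.ulift (R₁ := ℝ) (M₁ := ℝ)).symm.toContinuousLinearMap.comp f
  have hT : ∀ y, ‖T y‖ = |f y| := fun y => rfl
  have := h (ULift.{v} ℝ) T (fun y hy => by
    simp only [hT]
    simpa using (isWeaklyNull_iff.1 hy f).abs) x hx (isUAWNull_of_disjoint hd)
  simp only [hT] at this
  exact (tendsto_zero_iff_abs_tendsto_zero _).2 this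

omit [HasSolidNorm E] in
theorem DisjointSequencesWeaklyNull.isWeaklyNull_of_norm_le (h : DisjointSequencesWeaklyNull E)
    {z : ℕ → E} {R : ℝ} (h0 : ∀ n, 0 ≤ z n) (hR : ∀ n, ‖z n‖ ≤ R)
    (hd : Pairwise fun m n => z m ⊓ z n = 0) : IsWeaklyNull z := by
  refine h z (isBounded_iff_forall_norm_le.2 ⟨R, by rintro _ ⟨n, rfl⟩; exact hR n⟩) ?_
  simpa only [abs_of_nonneg (h0 _)] using hd

variable [CompleteSpace E] [IsOrderedModule ℝ E]

theorem DisjointSequencesWeaklyNull.isOrderContinuous (h : DisjointSequencesWeaklyNull E) :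
    IsOrderContinuous (StrongDual ℝ E) := by
  intro ι _ _ _ x hx hglb
  have hx0 : ∀ i, 0 ≤ x i := fun i => hglb.1 ⟨i, rfl⟩
  have hx0' : ∀ i y, 0 ≤ y → 0 ≤ x i y := fun i y hy => by simpa using hx0 i y hy
  have hbdd : ∀ y, 0 ≤ y → BddBelow (Set.range fun i => x i y) := fun y hy =>
    ⟨0, by rintro _ ⟨i, rfl⟩; exact hx0' i y hy⟩
  have hlim : ∀ y, 0 ≤ y → Tendsto (fun i => x i y) atTop (𝓝 (⨅ i, x i y)) := fun y hy =>
    tendsto_atTop_ciInf (fun i j hij => hx hij y hy) (hbdd y hy)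
  obtain ⟨i₀⟩ := ‹Nonempty ι›
  have : Nonempty ι := ⟨i₀⟩
  obtain ⟨g, hg⟩ := StrongDual.exists_eq_on_nonneg (φ := fun y => ⨅ i, x i y) (x i₀)
    (fun y z hy hz => tendsto_nhds_unique (hlim _ (add_nonneg hy hz)) (by
      simpa only [map_add] using (hlim y hy).add (hlim z hz)))
    (fun y hy => le_ciInf fun i => hx0' i y hy) (fun y hy => ciInf_le (hbdd y hy) i₀)
  have hg0 : g ≤ 0 := hglb.2 (by
    rintro _ ⟨i, rfl⟩ y hy
    rw [hg y hy]
    exact ciInf_le (hbdd y hy) i)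
  have hlim0 : ∀ y, 0 ≤ y → Tendsto (fun i => x i y) atTop (𝓝 0) := fun y hy => by
    have h1 := hlim y hy
    rwa [← hg y hy, le_antisymm (hg0 y hy) (by
      rw [hg y hy]; exact le_ciInf fun i => hx0' i y hy)] at h1
  refine tendsto_order.2 ⟨fun a ha => Eventually.of_forall fun i => ha.trans_le (norm_nonneg _),
    fun ε hε => ?_⟩
  -- One `w`, chosen for `x i₀`, serves all later `x i`, since they are dominated by `x i₀`.
  obtain ⟨w, hw0, hw⟩ := exists_forall_posPart_sub_le (p := x i₀) (C := ‖x i₀‖) (R := 1)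
    (fun y z => by
      rw [← map_sub]
      exact apply_le_norm_mul le_rfl)
    (fun z hz0 hz1 hzd => isWeaklyNull_iff.1 (h.isWeaklyNull_of_norm_le hz0 hz1 hzd) (x i₀))
    (show 0 < ε / 3 by positivity)
  filter_upwards [(hlim0 w hw0).eventually_lt_const (show 0 < ε / 3 by positivity),
    eventually_ge_atTop i₀] with i hi hii
  refine (StrongDual.norm_le_of_apply_le (c := ε / 3 + ε / 3) (by positivity)
    fun y hy hy1 => ?_).trans_lt (by linarith)
  rw [abs_of_nonneg (hx0 i)]
  exact (apply_le_apply_add_apply_posPart_sub (hx0 i) y w).trans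
    (add_le_add hi.le ((hx hii _ (posPart_nonneg _)).trans (hw y hy hy1)))

theorem DisjointSequencesWeaklyNull.isLWeaklyCompact (h : DisjointSequencesWeaklyNull E)
    {A : Set (StrongDual ℝ E)} (hA : A.Nonempty) (hL : IsLSet A) : IsLWeaklyCompact A := by
  refine ⟨hA, hL.1, fun x hx hd => ?_⟩
  obtain ⟨C, hC⟩ := hL.1.exists_norm_le
  have hxA : ∀ n y, 0 ≤ y → |x n| y ≤ absSup A y := fun n y hy => by
    obtain ⟨a, ha, hxa⟩ := hx n
    refine (hxa y hy).trans ?_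
    simpa only [abs_of_nonneg hy] using le_absSup hC ha y
  refine tendsto_order.2 ⟨fun a ha => Eventually.of_forall fun i => ha.trans_le (norm_nonneg _),
    fun ε hε => ?_⟩
  obtain ⟨w, hw0, hw⟩ := exists_forall_posPart_sub_le (R := 1) (absSup_sub_le hA hC)
    (fun z hz0 hz1 hzd => hL.tendsto_absSup hA hz0 (h.isWeaklyNull_of_norm_le hz0 hz1 hzd))
    (show 0 < ε / 3 by positivity)
  -- Positive sequences with partial sums below `w` are weakly null, so the seminorm tends to `0`
  -- along them.
  have hxw : Tendsto (fun n => |x n| w) atTop (𝓝 0) := tendsto_apply_of_disjoint hw0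
    (fun d hd0 hdw => hL.tendsto_absSup hA hd0 (isWeaklyNull_of_sum_le hd0 hdw))
    (fun n => abs_nonneg _) hd hxA
  filter_upwards [hxw.eventually_lt_const (show 0 < ε / 3 by positivity)] with n hn
  refine (StrongDual.norm_le_of_apply_le (c := ε / 3 + ε / 3) (by positivity)
    fun y hy hy1 => ?_).trans_lt (by linarith)
  exact (apply_le_apply_add_apply_posPart_sub (abs_nonneg _) y w).trans
    (add_le_add hn.le ((hxA n _ (posPart_nonneg _)).trans (hw y hy hy1)))

theorem DisjointSequencesWeaklyNull.isUAWDunfordPettis (h : DisjointSequencesWeaklyNull E)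
    {X : Type v} [NormedAddCommGroup X] [NormedSpace ℝ X] {T : E →L[ℝ] X}
    (hT : IsDunfordPettis T) : IsUAWDunfordPettis T := by
  intro x hx huaw
  obtain ⟨R, hR⟩ := hx.exists_norm_le
  -- Applied to `x` and `-x`, this treats both parts of `x n`.
  have hpos : ∀ y : ℕ → E, (∀ n, |y n| = |x n|) →
      Tendsto (fun n => ‖T (y n)⁺‖) atTop (𝓝 0) := fun y hy => by
    refine tendsto_order.2 ⟨fun a ha => Eventually.of_forall fun i => ha.trans_le (norm_nonneg _),
      fun ε hε => ?_⟩
    obtain ⟨w, hw0, hw⟩ := exists_forall_posPart_sub_le (p := fun y => ‖T y‖) (C := ‖T‖) (R := R)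
      (fun y z => by
        refine (norm_sub_norm_le _ _).trans ?_
        rw [← map_sub]
        exact T.le_opNorm _)
      (fun z hz0 hz1 hzd => hT z (h.isWeaklyNull_of_norm_le hz0 hz1 hzd))
      (show 0 < ε / 2 by positivity)
    have h1 := hT (fun n => (y n)⁺ ⊓ w) (isWeaklyNull_of_abs_le (huaw w hw0) fun n => by
      rw [← hy n]; exact inf_posPart_abs_le hw0)
    filter_upwards [h1.eventually_lt_const (show 0 < ε / 2 by positivity)] with n hn
    have h2 : ‖(y n)⁺‖ ≤ R := (norm_le_norm_of_abs_le_abs (by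
      rw [abs_of_nonneg (posPart_nonneg _), ← hy n]
      exact sup_le (le_abs_self _) (abs_nonneg _))).trans (hR _ ⟨n, rfl⟩)
    have h3 := hw _ (posPart_nonneg (y n)) h2
    rw [← inf_add_posPart_sub (y n)⁺ w, map_add]
    exact (norm_add_le _ _).trans_lt (by linarith)
  have h1 := hpos x fun n => rfl
  have h2 := hpos (fun n => -x n) fun n => abs_neg _
  simp only [posPart_neg] at h2
  refine squeeze_zero (fun n => norm_nonneg _) (fun n => ?_) (by simpa using h1.add h2)
  conv_lhs => rw [← posPart_sub_negPart (x n), map_sub]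
  exact norm_sub_le _ _

end Characterizations

theorem mainTheorem6 {E : Type u} [NormedAddCommGroup E] [NormedSpace ℝ E] [CompleteSpace E]
    [Lattice E] [IsOrderedAddMonoid E] [IsOrderedModule ℝ E] [HasSolidNorm E] :
    List.TFAE [
      IsOrderContinuous (StrongDual ℝ E),
      ∀ A : Set (StrongDual ℝ E), A.Nonempty → IsLSet A → IsLWeaklyCompact A,
      ∀ (X : Type v) [NormedAddCommGroup X] [NormedSpace ℝ X] [CompleteSpace X]
        (T : E →L[ℝ] X), IsDunfordPettis T → IsUAWDunfordPettis T] := by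
  tfae_have 1 → 2 := fun h _ hA hL => h.disjointSequencesWeaklyNull.isLWeaklyCompact hA hL
  tfae_have 2 → 3 := fun h _ _ _ _ _ hT =>
    (disjointSequencesWeaklyNull_of_isLWeaklyCompact h).isUAWDunfordPettis hT
  tfae_have 3 → 1 := fun h =>
    (disjointSequencesWeaklyNull_of_isUAWDunfordPettis h).isOrderContinuous
  tfae_finish
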